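/- Let $\Sigma$ be a finite alphabet, $Q$ a finite set of states and $d\in\mathbb N$. A Parikh automaton of dimension $d$ is a tuple $\mathcal A=(\Sigma,Q,q_I,F,C,\Delta)$ with initial state $q_I\in Q$, final states $F\subseteq Q$, a semilinear set $C\subseteq\mathbb N^d$ (a finite union of sets $\{c+\lambda_1p_1+\cdots+\lambda_kp_k:\lambda_1,\dots,\lambda_k\in\mathbb N\}$ with $c,p_1,\dots,p_k\in\mathbb N^d$) and a finite set of transitions $\Delta\subseteq Q\times(\Sigma\times\mathbb N^d)\times Q$. A run is a sequence $$q_0\xrightarrow{a_1,v_1}q_1\xrightarrow{a_2,v_2}q_2\cdots q_{n-1}\xrightarrow{a_n,v_n}q_n\qquad(n\ge 0)$$ with $(q_{i-1},(a_i,v_i),q_i)\in\Delta$ for $1\le i\le n$; it is labelled by the word $a_1\cdots a_n$, and it is accepting if $q_0=q_I$, $q_n\in F$ and $v_1+\cdots+v_n\in C$. The language $\mathcal L(\mathcal A)\subseteq\Sigma^*$ is the set of words that label an accepting run, and $\mathcal A$ is weakly-unambiguous if every word labels at most one accepting run. A power series $A(x)\in\mathbb Q[[x]]$ is holonomic if the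 $\mathbb Q(x)$-vector space spanned by the derivatives $\partial_x^iA(x)$, $i\in\mathbb N$, has finite dimension. **Proposition.** If $\mathcal A$ is a weakly-unambiguous Parikh automaton, then the univariate generating series of its language, $\sum_{n\ge 0}\ell_nx^n$, where $\ell_n$ is the number of words of length $n$ in $\mathcal L(\mathcal A)$, is holonomic. -/

import Mathlib

open scoped PowerSeries LaurentSeries RatFunc

/-- A Parikh automaton of dimension `d` over the alphabet `α` with set of states `Q`:
an initial state, a set of final states, a semilinear constraint `C ⊆ ℕ^d` and a finite set of
transitions `p --(a, v)--> q`, stored as `(p, (a, v), q)`.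
The alphabet and the set of states are taken to be finite where the automata are used. -/
structure ParikhAutomaton (α Q : Type*) (d : ℕ) where
  initial : Q
  final : Set Q
  constraint : Set (Fin d → ℕ)
  semilinear_constraint : IsSemilinearSet constraint
  transitions : Set (Q × (α × (Fin d → ℕ)) × Q)
  finite_transitions : transitions.Finite

/-- A sequence `q₀ --(a₁, v₁)--> q₁ --(a₂, v₂)--> q₂ ⋯ --(aₙ, vₙ)--> qₙ` (with `n ≥ 0`): the first
state `q₀` and the list of the steps `((aᵢ, vᵢ), qᵢ)`. -/
structure ParikhRun (α Q : Type*) (d : ℕ) where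
  source : Q
  steps : List ((α × (Fin d → ℕ)) × Q)

namespace ParikhRun

variable {α Q : Type*} {d : ℕ}

/-- The last state `qₙ` (which is `q₀` if `n = 0`). -/
def target (π : ParikhRun α Q d) : Q := (π.steps.map fun s => s.2).getLastD π.source

/-- The word `a₁ ⋯ aₙ`. -/
def word (π : ParikhRun α Q d) : List α := π.steps.map fun s => s.1.1

/-- The vector `v₁ + ⋯ + vₙ`. -/
def vector (π : ParikhRun α Q d) : Fin d → ℕ := (π.steps.map fun s => s.1.2).sum

end ParikhRun

namespace ParikhAutomaton

variable {α Q : Type*} {d : ℕ}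

/-- All the steps, the first of which leaves the given state, are transitions of the automaton. -/
def StepsFrom (A : ParikhAutomaton α Q d) : Q → List ((α × (Fin d → ℕ)) × Q) → Prop
  | _, [] => True
  | p, (l, q) :: s => (p, l, q) ∈ A.transitions ∧ A.StepsFrom q s

/-- `π` is a run of `A`. -/
def IsRun (A : ParikhAutomaton α Q d) (π : ParikhRun α Q d) : Prop :=
  A.StepsFrom π.source π.steps

/-- `π` is an accepting run of `A`. -/
def IsAcceptingRun (A : ParikhAutomaton α Q d) (π : ParikhRun α Q d) : Prop :=
  A.IsRun π ∧ π.source = A.initial ∧ π.target ∈ A.final ∧ π.vector ∈ A.constraint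

/-- The language of the words that label an accepting run. -/
def language (A : ParikhAutomaton α Q d) : Language α :=
  {w | ∃ π : ParikhRun α Q d, A.IsAcceptingRun π ∧ π.word = w}

/-- Every word labels at most one accepting run. -/
def WeaklyUnambiguous (A : ParikhAutomaton α Q d) : Prop :=
  ∀ (w : List α) (π π' : ParikhRun α Q d), A.IsAcceptingRun π → π.word = w →
    A.IsAcceptingRun π' → π'.word = w → π = π'

end ParikhAutomaton

/-- The univariate generating series of a language over a finite alphabet: the coefficient of `X ^ n`
is the number of words of length `n` in the language. -/
noncomputable def languageGenSeries {α : Type*} (L : Language α) : ℚ⟦X⟧ :=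
  PowerSeries.mk fun n => (Set.ncard {w : List α | w ∈ L ∧ w.length = n} : ℚ)

/-- A univariate power series over `ℚ` is holonomic (D-finite) if it and all its iterated
derivatives span a finite-dimensional vector space over the field `ℚ(X)` of rational fractions. The
span is taken in the field of formal Laurent series, an extension of `ℚ(X)` that contains `ℚ⟦X⟧`. -/
def IsHolonomic (F : ℚ⟦X⟧) : Prop :=
  FiniteDimensional (RatFunc ℚ)
    (Submodule.span (RatFunc ℚ)
      (Set.range fun n : ℕ => (((PowerSeries.derivative ℚ)^[n] F : ℚ⟦X⟧) : ℚ⸨X⸩)))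

/-! Weak unambiguity turns counting words into counting accepting runs. The constraint is a finite
union of linear sets with independent periods, and inclusion-exclusion reduces the count to runs
whose vector lies in every member of a subfamily `J`. No intersection is computed: the vector is
repeated once per member of `J`, and the constraint becomes a product of proper linear sets, whose
generating series is rational (`isRational_indicatorSeries_liftSet`).

If `K` bounds all transition vectors, give a step of vector `v` the weight `(1, K - v)`. Runs then
have a rational series by the transfer matrix (`isRational_pathSeries`). In its product with the
series of the constraint set, the coefficient at `(n, n K)` counts the runs of length `n` whose
vector is in the set. So each term is a diagonal of a rational series.

Such diagonals are holonomic (`IsRational.isHolonomic_diagonal`) by a dimension count. In `s + 1`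
variables, the roughly `N ^ (s + 2)` operators `t ^ a * θ ^ b * W ^ m` with exponents at most `N`
send `g` into a space of dimension `O(N ^ (s + 1))`, so some nonzero combination kills `g`. Reading
it on the diagonal shifted by a minimal `m` isolates the terms in `W ^ m` and leaves a nonzero
differential equation for the diagonal. -/

namespace MvPowerSeries

/-! ### Polynomials, rational series and Euler operators in several variables -/

variable {τ : Type*}

/-- The linear operator multiplying the coefficient of exponent `e` by `φ e`. -/
noncomputable def weightMul (φ : (τ →₀ ℕ) → ℚ) : MvPowerSeries τ ℚ →ₗ[ℚ] MvPowerSeries τ ℚ where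
  toFun f := fun e => φ e * coeff e f
  map_add' f g := by ext e; exact mul_add _ _ _
  map_smul' c f := by ext e; exact mul_left_comm _ _ _

@[simp] theorem coeff_weightMul (φ : (τ →₀ ℕ) → ℚ) (f : MvPowerSeries τ ℚ) (e : τ →₀ ℕ) :
    coeff e (weightMul φ f) = φ e * coeff e f := rfl

/-- An additive weight on the exponents gives a derivation. -/
noncomputable def weightDerivation (w : (τ →₀ ℕ) →+ ℚ) :
    Derivation ℚ (MvPowerSeries τ ℚ) (MvPowerSeries τ ℚ) :=
  Derivation.mk' (weightMul w) fun f g => by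
    classical
    ext e
    simp only [smul_eq_mul, mul_comm g, coeff_weightMul, coeff_mul, map_add, Finset.mul_sum,
      ← Finset.sum_add_distrib]
    refine Finset.sum_congr rfl fun x hx => ?_
    rw [← Finset.HasAntidiagonal.mem_antidiagonal.1 hx, map_add]
    ring

theorem weightDerivation_apply (w : (τ →₀ ℕ) →+ ℚ) (f : MvPowerSeries τ ℚ) :
    weightDerivation w f = weightMul w f := rfl

variable (τ) in
/-- The space of the polynomials of degree at most `m` in each variable. -/
def boxPoly (m : ℕ) : Submodule ℚ (MvPowerSeries τ ℚ) where
  carrier := {f | ∀ e, coeff e f ≠ 0 → ∀ i, e i ≤ m}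
  zero_mem' := fun e h => (h (by simp)).elim
  add_mem' {f g} hf hg e h := by
    by_cases h1 : coeff e f = 0
    · exact hg e (by simpa [h1] using h)
    · exact hf e h1
  smul_mem' c f hf e h := hf e fun h1 => h (by simp [h1])

theorem boxPoly_mono {m n : ℕ} (h : m ≤ n) : boxPoly τ m ≤ boxPoly τ n :=
  fun _ hf e he i => (hf e he i).trans h

theorem mul_mem_boxPoly {m n : ℕ} {f g : MvPowerSeries τ ℚ} (hf : f ∈ boxPoly τ m)
    (hg : g ∈ boxPoly τ n) : f * g ∈ boxPoly τ (m + n) := by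
  classical
  intro e he i
  rw [coeff_mul] at he
  obtain ⟨x, hx, h⟩ := Finset.exists_ne_zero_of_sum_ne_zero he
  rw [← Finset.HasAntidiagonal.mem_antidiagonal.1 hx]
  exact add_le_add (hf _ (left_ne_zero_of_mul h) i) (hg _ (right_ne_zero_of_mul h) i)

theorem weightMul_mem_boxPoly {m : ℕ} (φ : (τ →₀ ℕ) → ℚ) {f : MvPowerSeries τ ℚ}
    (hf : f ∈ boxPoly τ m) : weightMul φ f ∈ boxPoly τ m :=
  fun e he => hf e (right_ne_zero_of_mul he)

theorem monomial_mem_boxPoly {m : ℕ} {u : τ →₀ ℕ} (hu : ∀ i, u i ≤ m) (c : ℚ) :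
    monomial u c ∈ boxPoly τ m := by
  classical
  intro e he
  rw [coeff_monomial] at he
  by_cases h : e = u
  · exact h ▸ hu
  · simp [h] at he

theorem one_mem_boxPoly (m : ℕ) : (1 : MvPowerSeries τ ℚ) ∈ boxPoly τ m := by
  rw [← monomial_zero_one]
  exact monomial_mem_boxPoly (by simp) 1

theorem pow_mem_boxPoly {m : ℕ} {f : MvPowerSeries τ ℚ} (hf : f ∈ boxPoly τ m) (s : ℕ) :
    f ^ s ∈ boxPoly τ (s * m) := by
  induction s with
  | zero => simpa using one_mem_boxPoly 0
  | succ s ih =>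
    rw [pow_succ, Nat.succ_mul]
    exact mul_mem_boxPoly ih hf

variable (τ) in
/-- The subalgebra of the polynomials. -/
def polySubalgebra : Subalgebra ℚ (MvPowerSeries τ ℚ) where
  carrier := {f | ∃ m, f ∈ boxPoly τ m}
  mul_mem' := fun ⟨m, hm⟩ ⟨n, hn⟩ => ⟨m + n, mul_mem_boxPoly hm hn⟩
  add_mem' := fun ⟨m, hm⟩ ⟨n, hn⟩ => ⟨max m n, add_mem (boxPoly_mono (le_max_left _ _) hm)
    (boxPoly_mono (le_max_right _ _) hn)⟩
  algebraMap_mem' r := ⟨0, by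
    rw [Algebra.algebraMap_eq_smul_one]
    exact Submodule.smul_mem _ _ (one_mem_boxPoly 0)⟩

/-- A power series is rational if it is the quotient of two polynomials. -/
def IsRational (f : MvPowerSeries τ ℚ) : Prop :=
  ∃ q ∈ polySubalgebra τ, q ≠ 0 ∧ q * f ∈ polySubalgebra τ

theorem IsRational.mul {f g : MvPowerSeries τ ℚ} (hf : IsRational f) (hg : IsRational g) :
    IsRational (f * g) := by
  obtain ⟨q, hq, hq0, hqf⟩ := hf
  obtain ⟨r, hr, hr0, hrg⟩ := hg
  refine ⟨q * r, mul_mem hq hr, mul_ne_zero hq0 hr0, ?_⟩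
  rw [mul_mul_mul_comm]
  exact mul_mem hqf hrg

/-- Applying `L` factors of degree at most one in Euler operators to a rational series of
denominator `q` gives a denominator `q ^ (L + 1)` and a numerator of degree linear in `L`. -/
theorem pow_mul_weightMul_mem_boxPoly {δ : ℕ} {q g : MvPowerSeries τ ℚ} (hq : q ∈ boxPoly τ δ)
    (hg : q * g ∈ boxPoly τ δ) (l : List (((τ →₀ ℕ) →+ ℚ) × ℚ)) :
    q ^ (l.length + 1) * weightMul (fun e => (l.map fun w => w.1 e + w.2).prod) g ∈
      boxPoly τ ((l.length + 1) * δ) := by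
  induction l with
  | nil =>
    have : weightMul (fun _ : τ →₀ ℕ => (1 : ℚ)) g = g := by ext e; simp
    simpa [this] using hg
  | cons w l ih =>
    set φ : (τ →₀ ℕ) → ℚ := fun e => (l.map fun w => w.1 e + w.2).prod with hφ
    set h := weightMul φ g
    have h1 : weightMul (fun e => ((w :: l).map fun w => w.1 e + w.2).prod) g =
        weightDerivation w.1 h + w.2 • h := by
      ext e
      simp [weightDerivation_apply, h, φ]
      ring
    -- Quotient rule: each derivation costs one more factor `q`, not a squared denominator.
    have h2 : q ^ (l.length + 1 + 1) * weightDerivation w.1 h =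
        q * weightDerivation w.1 (q ^ (l.length + 1) * h)
          - ((l.length + 1 : ℕ) : ℚ) • (weightDerivation w.1 q * (q ^ (l.length + 1) * h)) := by
      rw [Derivation.leibniz, Derivation.leibniz_pow]
      simp only [smul_eq_mul, Nat.add_sub_cancel, ← Nat.cast_smul_eq_nsmul ℚ,
        Algebra.smul_def]
      ring
    rw [h1, mul_add, List.length_cons, h2, Nat.succ_mul, add_comm _ δ]
    refine add_mem (sub_mem (mul_mem_boxPoly hq (weightMul_mem_boxPoly _ ih))
      (Submodule.smul_mem _ _ (mul_mem_boxPoly (weightMul_mem_boxPoly _ hq) ih))) ?_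
    rw [pow_succ', mul_assoc, mul_smul_comm]
    exact mul_mem_boxPoly hq (Submodule.smul_mem _ _ ih)

end MvPowerSeries

/-! ### Closure properties of holonomic series -/

/-- The space spanned over `ℚ(X)` by the iterated derivatives of a power series. -/
noncomputable abbrev derivativeSpan (F : ℚ⟦X⟧) : Submodule (RatFunc ℚ) ℚ⸨X⸩ :=
  Submodule.span (RatFunc ℚ)
    (Set.range fun n : ℕ => (((PowerSeries.derivative ℚ)^[n] F : ℚ⟦X⟧) : ℚ⸨X⸩))

theorem derivative_mem_derivativeSpan (F : ℚ⟦X⟧) (n : ℕ) :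
    (((PowerSeries.derivative ℚ)^[n] F : ℚ⟦X⟧) : ℚ⸨X⸩) ∈ derivativeSpan F :=
  Submodule.subset_span ⟨n, rfl⟩

theorem IsHolonomic.of_forall_mem {F : ℚ⟦X⟧} (W : Submodule (RatFunc ℚ) ℚ⸨X⸩)
    [FiniteDimensional (RatFunc ℚ) W]
    (h : ∀ n : ℕ, (((PowerSeries.derivative ℚ)^[n] F : ℚ⟦X⟧) : ℚ⸨X⸩) ∈ W) : IsHolonomic F :=
  Submodule.finiteDimensional_of_le (S₂ := W) (Submodule.span_le.2 (by rintro _ ⟨n, rfl⟩; exact h n))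

theorem isHolonomic_zero : IsHolonomic 0 := by
  refine IsHolonomic.of_forall_mem ⊥ fun n => ?_
  rw [iterate_map_zero]
  simp

theorem IsHolonomic.add {F G : ℚ⟦X⟧} (hF : IsHolonomic F) (hG : IsHolonomic G) :
    IsHolonomic (F + G) := by
  have : FiniteDimensional (RatFunc ℚ) (derivativeSpan F) := hF
  have : FiniteDimensional (RatFunc ℚ) (derivativeSpan G) := hG
  refine IsHolonomic.of_forall_mem (derivativeSpan F ⊔ derivativeSpan G) fun n => ?_
  rw [iterate_map_add, map_add]
  exact Submodule.add_mem_sup (derivative_mem_derivativeSpan F n)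
    (derivative_mem_derivativeSpan G n)

theorem IsHolonomic.sum {ι : Type*} {s : Finset ι} {F : ι → ℚ⟦X⟧}
    (hF : ∀ i ∈ s, IsHolonomic (F i)) : IsHolonomic (∑ i ∈ s, F i) :=
  Finset.sum_induction F IsHolonomic (fun _ _ => IsHolonomic.add) isHolonomic_zero hF

theorem IsHolonomic.zsmul {F : ℚ⟦X⟧} (c : ℤ) (hF : IsHolonomic F) : IsHolonomic (c • F) := by
  have : FiniteDimensional (RatFunc ℚ) (derivativeSpan F) := hF
  refine IsHolonomic.of_forall_mem (derivativeSpan F) fun n => ?_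
  have h : (PowerSeries.derivative ℚ)^[n] (c • F) = c • (PowerSeries.derivative ℚ)^[n] F := by
    induction n with
    | zero => rfl
    | succ n ih => rw [Function.iterate_succ_apply', ih, map_zsmul, Function.iterate_succ_apply']
  rw [h, map_zsmul]
  exact zsmul_mem (derivative_mem_derivativeSpan F n) c

/-! ### Differential equations in terms of the Euler operator -/

namespace PowerSeries

/-- The Euler operator `X * d/dX`. -/
noncomputable def euler : Derivation ℚ ℚ⟦X⟧ ℚ⟦X⟧ := (X : ℚ⟦X⟧) • derivative ℚ

theorem euler_apply (F : ℚ⟦X⟧) : euler F = X * derivative ℚ F := rfl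

theorem coeff_euler (F : ℚ⟦X⟧) (n : ℕ) : coeff n (euler F) = n * coeff n F := by
  cases n with
  | zero => simp [euler_apply]
  | succ n =>
    rw [euler_apply, coeff_succ_X_mul, coeff_derivative]
    push_cast
    ring

theorem coeff_iterate_euler (F : ℚ⟦X⟧) (b n : ℕ) :
    coeff n (euler^[b] F) = (n : ℚ) ^ b * coeff n F := by
  induction b with
  | zero => simp
  | succ b ih => rw [Function.iterate_succ_apply', coeff_euler, ih]; ring

/-- The `ℚ[X]`-span of the first `m` iterated Euler derivatives. -/
noncomputable def eulerSpan (F : ℚ⟦X⟧) (m : ℕ) : Submodule (Polynomial ℚ) ℚ⟦X⟧ :=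
  Submodule.span _ ((fun b => euler^[b] F) '' Set.Iio m)

theorem iterate_euler_mem_eulerSpan (F : ℚ⟦X⟧) {b m : ℕ} (h : b < m) :
    euler^[b] F ∈ eulerSpan F m := Submodule.subset_span ⟨b, h, rfl⟩

theorem eulerSpan_mono (F : ℚ⟦X⟧) {m n : ℕ} (h : m ≤ n) : eulerSpan F m ≤ eulerSpan F n :=
  Submodule.span_mono (Set.image_mono (Set.Iio_subset_Iio h))

theorem polynomial_smul_eq (p : Polynomial ℚ) (F : ℚ⟦X⟧) : p • F = (p : ℚ⟦X⟧) * F := by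
  rw [Algebra.smul_def]; rfl

theorem euler_coe (p : Polynomial ℚ) :
    euler (p : ℚ⟦X⟧) = ((Polynomial.X * Polynomial.derivative p : Polynomial ℚ) : ℚ⟦X⟧) := by
  rw [euler_apply, derivative_coe]; simp

theorem euler_smul (p : Polynomial ℚ) (F : ℚ⟦X⟧) :
    euler (p • F) = p • euler F + (Polynomial.X * Polynomial.derivative p) • F := by
  simp only [polynomial_smul_eq, Derivation.leibniz, smul_eq_mul, euler_coe]
  ring

theorem euler_mem_eulerSpan {F G : ℚ⟦X⟧} {m : ℕ} (h : G ∈ eulerSpan F m) :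
    euler G ∈ eulerSpan F (m + 1) := by
  induction h using Submodule.span_induction with
  | mem x hx =>
    obtain ⟨b, hb, rfl⟩ := hx
    change euler (euler^[b] F) ∈ _
    rw [← Function.iterate_succ_apply' euler]
    exact iterate_euler_mem_eulerSpan F (Nat.succ_lt_succ hb)
  | zero => simp
  | add x y _ _ hx hy => rw [map_add]; exact add_mem hx hy
  | smul p x hx' hx =>
    rw [euler_smul]
    exact add_mem (Submodule.smul_mem _ _ hx)
      (Submodule.smul_mem _ _ (eulerSpan_mono F m.le_succ hx'))

/-- With `D` the derivative and `θ = X D`, one has `X ^ (i + 1) D ^ (i + 1) = (θ - i) X ^ i D ^ i`.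
-/
theorem X_pow_mul_derivative_mem_eulerSpan (F : ℚ⟦X⟧) (i : ℕ) :
    X ^ i * (derivative ℚ)^[i] F ∈ eulerSpan F (i + 1) := by
  induction i with
  | zero => simpa using iterate_euler_mem_eulerSpan F zero_lt_one
  | succ i ih =>
    have hi : ((i : Polynomial ℚ) : ℚ⟦X⟧) = (i : ℚ⟦X⟧) :=
      map_natCast Polynomial.coeToPowerSeries.ringHom i
    have h : X ^ (i + 1) * (derivative ℚ)^[i + 1] F =
        euler (X ^ i * (derivative ℚ)^[i] F)
          - (i : Polynomial ℚ) • (X ^ i * (derivative ℚ)^[i] F) := by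
      rw [Function.iterate_succ_apply', Derivation.leibniz, Derivation.leibniz_pow, euler_apply,
        euler_apply, polynomial_smul_eq, derivative_X, hi]
      cases i with
      | zero => simp
      | succ i =>
        simp only [smul_eq_mul, nsmul_eq_mul, Nat.add_sub_cancel]
        ring
    rw [h]
    exact sub_mem (euler_mem_eulerSpan ih)
      (Submodule.smul_mem _ _ (eulerSpan_mono F (Nat.le_succ _) ih))

/-- Differentiating the relation keeps its leading coefficient `p`; the term where `θ` hits `p` has
lower order. -/
theorem smul_iterate_euler_mem_eulerSpan {F : ℚ⟦X⟧} {p : Polynomial ℚ} {r : ℕ}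
    (h : p • euler^[r] F ∈ eulerSpan F r) (k : ℕ) :
    p • euler^[r + k] F ∈ eulerSpan F (r + k) := by
  induction k with
  | zero => exact h
  | succ k ih =>
    have h2 : p • euler^[r + (k + 1)] F = euler (p • euler^[r + k] F)
        - (Polynomial.X * Polynomial.derivative p) • euler^[r + k] F := by
      rw [euler_smul, ← add_assoc, Function.iterate_succ_apply' euler (r + k)]
      ring
    rw [h2]
    exact sub_mem (euler_mem_eulerSpan ih)
      (Submodule.smul_mem _ _ (iterate_euler_mem_eulerSpan F (by omega)))

theorem coe_polynomial_smul (p : Polynomial ℚ) (F : ℚ⟦X⟧) :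
    ((p • F : ℚ⟦X⟧) : ℚ⸨X⸩) = algebraMap (Polynomial ℚ) (RatFunc ℚ) p • (F : ℚ⸨X⸩) := by
  rw [polynomial_smul_eq, map_mul, Algebra.smul_def, ← IsScalarTower.algebraMap_apply]
  rfl

theorem isHolonomic_of_smul_iterate_euler_mem {F : ℚ⟦X⟧} {p : Polynomial ℚ} (hp : p ≠ 0) {r : ℕ}
    (h : p • euler^[r] F ∈ eulerSpan F r) : IsHolonomic F := by
  set W : Submodule (RatFunc ℚ) ℚ⸨X⸩ :=
    Submodule.span _ ((fun b => ((euler^[b] F : ℚ⟦X⟧) : ℚ⸨X⸩)) '' Set.Iio r) with hW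
  have : FiniteDimensional (RatFunc ℚ) W :=
    FiniteDimensional.span_of_finite _ ((Set.finite_Iio r).image _)
  have of_smul {q : Polynomial ℚ} (hq : q ≠ 0) {G : ℚ⟦X⟧} (hG : ((q • G : ℚ⟦X⟧) : ℚ⸨X⸩) ∈ W) :
      (G : ℚ⸨X⸩) ∈ W := by
    rw [coe_polynomial_smul] at hG
    have hq' : algebraMap (Polynomial ℚ) (RatFunc ℚ) q ≠ 0 := by simpa using hq
    exact (Submodule.smul_mem_iff _ hq').1 hG
  have of_span {m : ℕ} (hm : ∀ b < m, ((euler^[b] F : ℚ⟦X⟧) : ℚ⸨X⸩) ∈ W) {G : ℚ⟦X⟧}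
      (hG : G ∈ eulerSpan F m) : (G : ℚ⸨X⸩) ∈ W := by
    induction hG using Submodule.span_induction with
    | mem x hx => obtain ⟨b, hb, rfl⟩ := hx; exact hm b hb
    | zero => simp
    | add x y _ _ hx hy => rw [map_add]; exact add_mem hx hy
    | smul q x _ hx => rw [coe_polynomial_smul]; exact Submodule.smul_mem _ _ hx
  have hmem : ∀ m, ((euler^[m] F : ℚ⟦X⟧) : ℚ⸨X⸩) ∈ W := by
    intro m
    induction m using Nat.strong_induction_on with
    | _ m ih =>
      rcases lt_or_ge m r with hm | hm
      · exact Submodule.subset_span ⟨m, hm, rfl⟩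
      · obtain ⟨k, rfl⟩ := Nat.exists_eq_add_of_le hm
        exact of_smul hp (of_span ih (smul_iterate_euler_mem_eulerSpan h k))
  refine IsHolonomic.of_forall_mem W fun n => ?_
  -- `X ^ n` is invertible in `ℚ(X)`, so ordinary derivatives reduce to Euler derivatives.
  refine of_smul (q := Polynomial.X ^ n) (pow_ne_zero _ Polynomial.X_ne_zero) ?_
  rw [polynomial_smul_eq]
  have := X_pow_mul_derivative_mem_eulerSpan F n
  rw [← Polynomial.coe_X, ← Polynomial.coe_pow] at this
  exact of_span (fun b _ => hmem b) this

/-- A power series annihilated by a nonzero differential operator with polynomial coefficients,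
written in terms of the Euler operator, is holonomic. -/
theorem isHolonomic_of_sum_smul_iterate_euler_eq_zero {F : ℚ⟦X⟧} (N : ℕ) (p : ℕ → Polynomial ℚ)
    (h : ∑ b ∈ Finset.range N, p b • euler^[b] F = 0) (hp : ∃ b < N, p b ≠ 0) :
    IsHolonomic F := by
  induction N with
  | zero => simp at hp
  | succ N ih =>
    rw [Finset.sum_range_succ] at h
    by_cases h0 : p N = 0
    · refine ih (by simpa [h0] using h) ?_
      obtain ⟨b, hb, hb'⟩ := hp
      exact ⟨b, lt_of_le_of_ne (Nat.le_of_lt_succ hb) fun hbN => hb' (hbN ▸ h0), hb'⟩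
    · refine isHolonomic_of_smul_iterate_euler_mem h0 (r := N) ?_
      rw [← neg_eq_of_add_eq_zero_right h]
      exact neg_mem (sum_mem fun b hb => Submodule.smul_mem _ _
        (iterate_euler_mem_eulerSpan F (Finset.mem_range.1 hb)))

end PowerSeries

/-! ### Diagonals of rational series -/

namespace MvPowerSeries

variable {σ : Type*} [Fintype σ]

/-- The exponent with component `n` in the distinguished variable and `n * κ i + c i` in the
other variables. -/
noncomputable def diagExp (κ : σ → ℕ) (n : ℕ) (c : σ → ℕ) : Option σ →₀ ℕ :=
  Finsupp.equivFunOnFinite.symm fun o => o.elim n fun i => n * κ i + c i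

@[simp] theorem diagExp_none (κ : σ → ℕ) (n : ℕ) (c : σ → ℕ) : diagExp κ n c none = n := rfl

@[simp] theorem diagExp_some (κ : σ → ℕ) (n : ℕ) (c : σ → ℕ) (i : σ) :
    diagExp κ n c (some i) = n * κ i + c i := rfl

/-- The additive weight `e ↦ e i`. -/
noncomputable def coordWeight {τ : Type*} (i : τ) : (τ →₀ ℕ) →+ ℚ :=
  (Nat.castAddMonoidHom ℚ).comp (Finsupp.applyAddHom i)

@[simp] theorem coordWeight_apply {τ : Type*} (i : τ) (e : τ →₀ ℕ) : coordWeight i e = e i := rfl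

/-- The affine weights `e i - κ i * e none + j + 1` for `j < m i`. -/
noncomputable def residueWeights (κ m : σ → ℕ) : List (((Option σ →₀ ℕ) →+ ℚ) × ℚ) :=
  Finset.univ.toList.flatMap fun i : σ => (List.range (m i)).map fun j : ℕ =>
    (coordWeight (some i) - (κ i : ℚ) • coordWeight none, (j + 1 : ℚ))

/-- The affine weights of the operator indexed by `b` and `m`: the first variable `b` times, and
the weights `residueWeights κ m`. -/
noncomputable def opWeights (κ : σ → ℕ) (b : ℕ) (m : σ → ℕ) :
    List (((Option σ →₀ ℕ) →+ ℚ) × ℚ) :=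
  List.replicate b (coordWeight none, 0) ++ residueWeights κ m

theorem length_opWeights (κ : σ → ℕ) (b : ℕ) (m : σ → ℕ) :
    (opWeights κ b m).length = b + ∑ i, m i := by
  simp [opWeights, residueWeights, List.length_flatMap]

/-- The product of the affine weights `opWeights`. -/
noncomputable def opSymbol (κ : σ → ℕ) (b : ℕ) (m : σ → ℕ) (e : Option σ →₀ ℕ) : ℚ :=
  ((opWeights κ b m).map fun w => w.1 e + w.2).prod

/-- The action on `g` of `t ^ a * θ ^ b * W ^ m`, with `t` the monomial of exponent `diagExp κ 1 0`,
`θ` the Euler operator of the distinguished variable, and `W i = X i * (θ i - κ i * θ + 1)`. -/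
noncomputable def opApply (κ : σ → ℕ) (g : MvPowerSeries (Option σ) ℚ) (a b : ℕ) (m : σ → ℕ) :
    MvPowerSeries (Option σ) ℚ :=
  monomial (diagExp κ a m) 1 * weightMul (opSymbol κ b m) g

theorem coeff_opApply (κ : σ → ℕ) (g : MvPowerSeries (Option σ) ℚ) (a b : ℕ) (m : σ → ℕ)
    (e : Option σ →₀ ℕ) :
    coeff e (opApply κ g a b m) = if diagExp κ a m ≤ e then
      opSymbol κ b m (e - diagExp κ a m) * coeff (e - diagExp κ a m) g else 0 := by
  classical
  rw [opApply, coeff_monomial_mul]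
  simp

/-- On the diagonal shifted by `c`, the factor of index `i, j` in the symbol equals `c i - m i + j +
1`, which vanishes for `j = m i - c i - 1`. -/
theorem coeff_opApply_eq_zero (κ : σ → ℕ) (g : MvPowerSeries (Option σ) ℚ) (a b : ℕ)
    {m c : σ → ℕ} {i : σ} (hi : c i < m i) (n : ℕ) :
    coeff (diagExp κ n c) (opApply κ g a b m) = 0 := by
  rw [coeff_opApply]
  split_ifs with h
  · have h0 := h none
    have h1 := h (some i)
    simp only [diagExp_none, diagExp_some] at h0 h1
    refine mul_eq_zero_of_left (List.prod_eq_zero (List.mem_map.2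
      ⟨(coordWeight (some i) - (κ i : ℚ) • coordWeight none, ((m i - c i - 1 : ℕ) + 1 : ℚ)), ?_, ?_⟩)) _
    · refine List.mem_append_right _ (List.mem_flatMap.2 ⟨i, by simp, ?_⟩)
      exact List.mem_map.2 ⟨m i - c i - 1, List.mem_range.2 (by omega), rfl⟩
    · simp only [AddMonoidHom.sub_apply, AddMonoidHom.smul_apply, coordWeight_apply,
        Finsupp.tsub_apply, diagExp_none, diagExp_some, smul_eq_mul]
      rw [Nat.sub_sub, Nat.cast_sub h1, Nat.cast_sub h0, Nat.cast_sub (by omega)]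
      push_cast
      ring
  · rfl

/-- The constant `∏ i, (m i)!`. -/
noncomputable def residueConst (m : σ → ℕ) : ℚ :=
  ((residueWeights (fun _ => 0) m).map fun w => w.2).prod

theorem residueConst_ne_zero (m : σ → ℕ) : residueConst m ≠ 0 := by
  refine List.prod_ne_zero fun h => ?_
  simp only [residueWeights, List.mem_map, List.mem_flatMap] at h
  obtain ⟨_, ⟨i, -, j, -, rfl⟩, h⟩ := h
  exact Nat.cast_add_one_ne_zero j h

/-- For `c = m` those factors are the constants `j + 1`. What remains is the action of `X ^ a * θ ^
b` on the one-variable diagonal. -/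
theorem coeff_opApply_self (κ : σ → ℕ) (g : MvPowerSeries (Option σ) ℚ) (a b : ℕ)
    (m : σ → ℕ) (n : ℕ) :
    coeff (diagExp κ n m) (opApply κ g a b m) = residueConst m *
      if a ≤ n then ((n - a : ℕ) : ℚ) ^ b * coeff (diagExp κ (n - a) 0) g else 0 := by
  rw [coeff_opApply]
  by_cases h : a ≤ n
  · have hle : diagExp κ a m ≤ diagExp κ n m := by
      rintro (_ | i)
      · exact h
      · exact Nat.add_le_add_right (Nat.mul_le_mul_right _ h) _
    have hsub : diagExp κ n m - diagExp κ a m = diagExp κ (n - a) 0 := by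
      ext (_ | i)
      · rfl
      · simp [Nat.sub_mul, Nat.add_sub_add_right]
    rw [if_pos h, if_pos hle, hsub, ← mul_assoc]
    congr 1
    simp only [opSymbol, opWeights, residueConst, residueWeights, List.map_append,
      List.prod_append, List.map_replicate, List.prod_replicate, List.map_flatMap, List.map_map]
    rw [mul_comm]
    congr 1
    · congr 2
      funext i
      refine List.map_congr_left fun j _ => ?_
      simp [mul_comm]
    · simp
  · rw [if_neg h, if_neg fun hle => h (hle none), mul_zero]

theorem pow_mul_opApply_mem_boxPoly {δ N k : ℕ} {κ : σ → ℕ} (hκ : ∀ i, κ i ≤ k)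
    {q g : MvPowerSeries (Option σ) ℚ} (hq : q ∈ boxPoly _ δ) (hg : q * g ∈ boxPoly _ δ)
    {a b : ℕ} {m : σ → ℕ} (ha : a ≤ N) (hb : b ≤ N) (hm : ∀ i, m i ≤ N) :
    q ^ (N * (1 + Fintype.card σ) + 1) * opApply κ g a b m ∈
      boxPoly _ ((N * (1 + Fintype.card σ) + 1) * δ + N * (k + 1)) := by
  have hl : (opWeights κ b m).length ≤ N * (1 + Fintype.card σ) := by
    rw [length_opWeights, mul_add, mul_one, mul_comm N (Fintype.card σ)]
    refine add_le_add hb ((Finset.sum_le_card_nsmul _ _ N fun i _ => hm i).trans ?_)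
    simp
  -- Padding with `q ^ r` gives all the operators one common denominator.
  obtain ⟨r, hr⟩ := Nat.exists_eq_add_of_le (Nat.succ_le_succ hl)
  rw [Nat.succ_eq_add_one] at hr
  have h1 := mul_mem_boxPoly (pow_mem_boxPoly hq r)
    (pow_mul_weightMul_mem_boxPoly hq hg (opWeights κ b m))
  rw [← mul_assoc, ← pow_add, ← add_mul, add_comm r, ← Nat.succ_eq_add_one, ← hr] at h1
  rw [opApply, mul_left_comm, add_comm]
  refine mul_mem_boxPoly (monomial_mem_boxPoly ?_ 1) h1
  rintro (_ | i)
  · exact ha.trans (Nat.le_mul_of_pos_right _ k.succ_pos)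
  · rw [diagExp_some, mul_add, mul_one]
    exact add_le_add (Nat.mul_le_mul ha (hκ i)) (hm i)

/-- More vectors in the box space of degree `M` than its dimension are linearly dependent. -/
theorem exists_sum_smul_eq_zero_of_mem_boxPoly {τ I : Type*} [Fintype τ] [Fintype I] {M : ℕ}
    (hM : (M + 1) ^ Fintype.card τ < Fintype.card I) (v : I → MvPowerSeries τ ℚ)
    (hv : ∀ i, v i ∈ boxPoly τ M) : ∃ γ : I → ℚ, γ ≠ 0 ∧ ∑ i, γ i • v i = 0 := by
  classical
  let Φ : (I → ℚ) →ₗ[ℚ] ((τ → Fin (M + 1)) → ℚ) := LinearMap.pi fun u =>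
    (coeff (R := ℚ) (Finsupp.equivFunOnFinite.symm fun i => (u i : ℕ))).comp
      (Fintype.linearCombination ℚ v)
  have hlt : Module.finrank ℚ ((τ → Fin (M + 1)) → ℚ) < Module.finrank ℚ (I → ℚ) := by
    simpa using hM
  obtain ⟨γ, hγ, h0⟩ := (Submodule.ne_bot_iff _).1 (LinearMap.ker_ne_bot_of_finrank_lt hlt (f := Φ))
  refine ⟨γ, h0, ?_⟩
  have hmem : ∑ i, γ i • v i ∈ boxPoly τ M :=
    sum_mem fun i _ => Submodule.smul_mem _ _ (hv i)
  ext e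
  by_contra he
  have hle := hmem e he
  apply he
  have := congrFun hγ fun i => ⟨e i, Nat.lt_succ_of_le (hle i)⟩
  have he' : (Finsupp.equivFunOnFinite.symm fun i => e i) = e := by ext; rfl
  simpa [Φ, Fintype.linearCombination_apply, he'] using this

/-- There is a nonzero operator, polynomial in `t`, `θ` and the `W i`, that annihilates a
rational series. -/
theorem IsRational.exists_sum_opApply_eq_zero [DecidableEq σ] (κ : σ → ℕ) {g : MvPowerSeries (Option σ) ℚ}
    (hg : IsRational g) : ∃ (N : ℕ) (γ : Fin (N + 1) × Fin (N + 1) × (σ → Fin (N + 1)) → ℚ),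
      γ ≠ 0 ∧ ∑ x, γ x • opApply κ g x.1 x.2.1 (fun i => x.2.2 i) = 0 := by
  obtain ⟨q, ⟨δ₁, hq⟩, hq0, δ₂, hqg⟩ := hg
  obtain ⟨δ, hδ₁, hδ₂⟩ : ∃ δ, δ₁ ≤ δ ∧ δ₂ ≤ δ := ⟨max δ₁ δ₂, le_max_left _ _, le_max_right _ _⟩
  replace hq := boxPoly_mono hδ₁ hq
  replace hqg := boxPoly_mono hδ₂ hqg
  set k := Finset.univ.sup κ
  set s := Fintype.card σ with hs
  set C := (1 + s) * δ + (k + 1) with hC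
  -- The box has dimension at most `((N + 1) * C) ^ (s + 1)`, which for this `N` is `(N + 1) ^ (s +
  -- 1) * N`, less than the number `(N + 1) ^ (s + 2)` of operators.
  set N := C ^ (s + 1) with hN
  refine ⟨N, ?_⟩
  have hM : (N * (1 + s) + 1) * δ + N * (k + 1) + 1 ≤ (N + 1) * C := by
    rw [hC]
    nlinarith [Nat.zero_le (s * δ), Nat.zero_le k]
  obtain ⟨γ, hγ, h⟩ := exists_sum_smul_eq_zero_of_mem_boxPoly (τ := Option σ)
    (I := Fin (N + 1) × Fin (N + 1) × (σ → Fin (N + 1)))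
    (M := (N * (1 + s) + 1) * δ + N * (k + 1)) (by
      simp only [Fintype.card_option, Fintype.card_prod, Fintype.card_fin, Fintype.card_pi,
        Finset.prod_const, Finset.card_univ, ← hs]
      calc _ ≤ ((N + 1) * C) ^ (s + 1) := Nat.pow_le_pow_left hM _
        _ = (N + 1) ^ (s + 1) * N := by rw [mul_pow]
        _ < (N + 1) ^ (s + 1) * (N + 1) := by
          exact Nat.mul_lt_mul_of_pos_left (Nat.lt_succ_self _) (by positivity)
        _ = _ := by ring)
    (fun x => q ^ (N * (1 + s) + 1) * opApply κ g x.1 x.2.1 (fun i => x.2.2 i))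
    (fun x => pow_mul_opApply_mem_boxPoly (fun i => Finset.le_sup (Finset.mem_univ i)) hq hqg
      (Nat.le_of_lt_succ x.1.2) (Nat.le_of_lt_succ x.2.1.2)
      (fun i => Nat.le_of_lt_succ (x.2.2 i).2))
  refine ⟨γ, hγ, ?_⟩
  simp only [← mul_smul_comm, ← Finset.mul_sum] at h
  exact (mul_eq_zero.1 h).resolve_left (pow_ne_zero _ hq0)

/-- A diagonal of a rational power series in several variables is holonomic. -/
theorem IsRational.isHolonomic_diagonal (κ : σ → ℕ) {g : MvPowerSeries (Option σ) ℚ}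
    (hg : IsRational g) : IsHolonomic (PowerSeries.mk fun n => coeff (diagExp κ n 0) g) := by
  classical
  obtain ⟨N, γ, hγ, h⟩ := hg.exists_sum_opApply_eq_zero κ
  -- Minimality for the product order: any other `m'` in the relation has `m i < m' i` for some `i`,
  -- so it contributes nothing on the diagonal shifted by `m`.
  obtain ⟨m, ⟨x, hx, hxm⟩, hmin⟩ := wellFounded_lt.has_min
    {m : σ → Fin (N + 1) | ∃ x, γ x ≠ 0 ∧ x.2.2 = m} (by
      obtain ⟨x, hx⟩ := Function.ne_iff.1 hγ
      exact ⟨_, x, hx, rfl⟩)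
  have key (n : ℕ) : ∑ b : Fin (N + 1), ∑ a : Fin (N + 1), γ (a, b, m) *
      (if (a : ℕ) ≤ n then ((n - a : ℕ) : ℚ) ^ (b : ℕ) * coeff (diagExp κ (n - a) 0) g else 0)
      = 0 := by
    have h1 := congrArg (coeff (diagExp κ n fun i => m i)) h
    rw [map_sum, map_zero, Fintype.sum_prod_type, Finset.sum_comm' (t' := Finset.univ)
      (s' := fun _ => Finset.univ) (by simp), Fintype.sum_prod_type] at h1
    have h2 (b : Fin (N + 1)) : ∑ m' : σ → Fin (N + 1), ∑ a : Fin (N + 1),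
        coeff (diagExp κ n fun i => m i) (γ (a, b, m') • opApply κ g a b fun i => m' i) =
        residueConst (fun i => (m i : ℕ)) * ∑ a : Fin (N + 1), γ (a, b, m) *
      (if (a : ℕ) ≤ n then ((n - a : ℕ) : ℚ) ^ (b : ℕ) * coeff (diagExp κ (n - a) 0) g else 0) := by
      rw [Finset.sum_eq_single m]
      · rw [Finset.mul_sum]
        refine Finset.sum_congr rfl fun a _ => ?_
        rw [coeff_smul, coeff_opApply_self, mul_left_comm]
      · intro m' _ hm'
        refine Finset.sum_eq_zero fun a _ => ?_
        by_cases hγ0 : γ (a, b, m') = 0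
        · simp [hγ0]
        · have hlt := hmin m' ⟨_, hγ0, rfl⟩
          have hle : ¬ m' ≤ m := fun hle => hlt (lt_of_le_of_ne hle hm')
          obtain ⟨i, hi⟩ := not_forall.1 hle
          rw [coeff_smul, coeff_opApply_eq_zero (i := i), mul_zero]
          exact not_le.1 hi
      · simp
    simp only [h2, ← Finset.mul_sum] at h1
    exact (mul_eq_zero.1 h1).resolve_left (residueConst_ne_zero _)
  -- The coefficient of `θ ^ b` is `∑ a, γ (a, b, m) X ^ a`; the index `x` witnesses that one of
  -- them is nonzero.
  refine PowerSeries.isHolonomic_of_sum_smul_iterate_euler_eq_zero (N + 1)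
    (fun b => if hb : b < N + 1 then
      ∑ a : Fin (N + 1), Polynomial.monomial (a : ℕ) (γ (a, ⟨b, hb⟩, m)) else 0) ?_
    ⟨x.2.1, x.2.1.2, ?_⟩
  · ext n
    rw [Finset.sum_range, map_sum, map_zero, ← key n]
    refine Finset.sum_congr rfl fun b _ => ?_
    rw [dif_pos b.2, Finset.sum_smul, map_sum]
    refine Finset.sum_congr rfl fun a _ => ?_
    rw [← Polynomial.C_mul_X_pow_eq_monomial, PowerSeries.polynomial_smul_eq, Polynomial.coe_mul,
      Polynomial.coe_C, Polynomial.coe_pow, Polynomial.coe_X, mul_assoc, PowerSeries.coeff_C_mul,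
      PowerSeries.coeff_X_pow_mul']
    simp [PowerSeries.coeff_iterate_euler]
  · rw [dif_pos x.2.1.2]
    intro h0
    have := congrArg (Polynomial.coeff · (x.1 : ℕ)) h0
    simp only [Polynomial.finsetSum_coeff, Polynomial.coeff_monomial, Fin.val_inj] at this
    simp only [Finset.sum_ite_eq', Finset.mem_univ, if_true, Polynomial.coeff_zero] at this
    subst hxm
    exact hx this


/-! ### Rational generating series of linear sets -/

variable {τ : Type*}

theorem monomial_mem_polySubalgebra (u : τ →₀ ℕ) (c : ℚ) : monomial u c ∈ polySubalgebra τ :=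
  ⟨u.degree, monomial_mem_boxPoly (fun i => Finsupp.le_degree i u) c⟩

/-- The generating series of a set of exponents. -/
noncomputable def indicatorSeries (s : Set (τ →₀ ℕ)) : MvPowerSeries τ ℚ :=
  fun e => s.indicator 1 e

theorem coeff_indicatorSeries (s : Set (τ →₀ ℕ)) (e : τ →₀ ℕ) :
    coeff e (indicatorSeries s) = s.indicator 1 e := rfl

/-- A product of geometric series. By injectivity of `P`, allowing a new period `a` gives the
disjoint union of the old set (`l a = 0`) and the new set translated by that period; multiplying by
`1 - monomial` of the period leaves the old set. -/
theorem prod_mul_indicatorSeries {ι : Type*} [DecidableEq ι] (P : (ι → ℕ) →+ (τ →₀ ℕ))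
    (hP : Function.Injective P) (s : Finset ι) :
    (∏ i ∈ s, (1 - monomial (P (Pi.single i 1)) (1 : ℚ))) *
      indicatorSeries (P '' {l | ∀ i ∉ s, l i = 0}) = 1 := by
  classical
  induction s using Finset.induction_on with
  | empty =>
    ext e
    have : {l : ι → ℕ | ∀ i ∉ (∅ : Finset ι), l i = 0} = {0} := by
      ext l
      simp [funext_iff]
    rw [Finset.prod_empty, one_mul, coeff_indicatorSeries, this, coeff_one, Set.indicator_apply]
    simp
  | insert a s ha ih =>
    rw [Finset.prod_insert ha, mul_comm (1 - _), mul_assoc]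
    refine (congrArg (_ * ·) ?_).trans ih
    ext e
    rw [sub_mul, one_mul, map_sub, coeff_monomial_mul, one_mul]
    simp only [coeff_indicatorSeries, Set.indicator_apply, Pi.one_apply]
    have shift (l : ι → ℕ) (hl : ∀ i ∉ insert a s, l i = 0) (h0 : l a ≠ 0) :
        ∃ l' : ι → ℕ, (∀ i ∉ insert a s, l' i = 0) ∧ l = Pi.single a 1 + l' := by
      refine ⟨fun i => l i - (Pi.single a 1 : ι → ℕ) i, fun i hi => by simp [hl i hi], ?_⟩
      ext i
      by_cases hia : i = a
      · subst hia
        simp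
        omega
      · simp [hia]
    by_cases he : e ∈ P '' {l | ∀ i ∉ insert a s, l i = 0}
    · obtain ⟨l, hl, rfl⟩ := he
      rw [if_pos ⟨l, hl, rfl⟩]
      by_cases h0 : l a = 0
      · rw [if_pos (c := P l ∈ P '' {l | ∀ i ∉ s, l i = 0}), sub_eq_self]
        · split_ifs with h1 h2
          · obtain ⟨l', hl', hll'⟩ := h2
            have := hP (a₁ := Pi.single a 1 + l') (a₂ := l) (by
              rw [map_add, hll', add_tsub_cancel_of_le h1])
            rw [← this] at h0
            simp at h0
          · rfl
          · rfl
        · refine ⟨l, fun i hi => ?_, rfl⟩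
          by_cases hia : i = a
          · exact hia ▸ h0
          · exact hl i (by simp [hia, hi])
      · rw [if_neg (c := P l ∈ P '' {l | ∀ i ∉ s, l i = 0})]
        · obtain ⟨l', hl', rfl⟩ := shift l hl h0
          rw [map_add, if_pos le_self_add, add_tsub_cancel_left, if_pos ⟨l', hl', rfl⟩, sub_self]
        · rintro ⟨l', hl', hll'⟩
          rw [← hP hll'] at h0
          exact h0 (hl' a ha)
    · rw [if_neg he, if_neg (c := e ∈ P '' {l | ∀ i ∉ s, l i = 0})]
      · rw [zero_sub, neg_eq_zero]
        split_ifs with h1 h2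
        · obtain ⟨l', hl', hll'⟩ := h2
          refine absurd ⟨Pi.single a 1 + l', fun i hi => ?_, ?_⟩ he
          · have hia : i ≠ a := fun h => hi (by simp [h])
            simp [hia, hl' i hi]
          · rw [map_add, hll', add_tsub_cancel_of_le h1]
        · rfl
        · rfl
      · rintro ⟨l, hl, rfl⟩
        exact he ⟨l, fun i hi => hl i fun h => hi (Finset.mem_insert_of_mem h), rfl⟩

/-- The generating series of a linear set with independent periods is rational. -/
theorem isRational_indicatorSeries {ι : Type*} [Finite ι] (P : (ι → ℕ) →+ (τ →₀ ℕ))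
    (hP : Function.Injective P) (c : τ →₀ ℕ) {s : Set (τ →₀ ℕ)}
    (hs : ∀ e, e ∈ s ↔ ∃ l, e = c + P l) : IsRational (indicatorSeries s) := by
  classical
  have := Fintype.ofFinite ι
  have h1 := prod_mul_indicatorSeries P hP Finset.univ
  have h2 : indicatorSeries s = monomial c 1 *
      indicatorSeries (P '' {l | ∀ i ∉ (Finset.univ : Finset ι), l i = 0}) := by
    ext e
    rw [coeff_monomial_mul, one_mul]
    simp only [coeff_indicatorSeries, Set.indicator_apply, Pi.one_apply]
    by_cases h : c ≤ e
    · rw [if_pos h]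
      congr 1
      rw [hs, eq_iff_iff]
      constructor
      · rintro ⟨l, rfl⟩
        exact ⟨l, by simp, by simp⟩
      · rintro ⟨l, -, hl⟩
        exact ⟨l, by rw [hl, add_tsub_cancel_of_le h]⟩
    · rw [if_neg h, if_neg]
      rw [hs]
      rintro ⟨l, rfl⟩
      exact h le_self_add
  refine ⟨∏ i : ι, (1 - monomial (P (Pi.single i 1)) (1 : ℚ)),
    prod_mem fun i _ => sub_mem (one_mem _) (monomial_mem_polySubalgebra _ _),
    left_ne_zero_of_mul (h1 ▸ one_ne_zero), ?_⟩
  rw [h2, mul_left_comm, h1, mul_one]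
  exact monomial_mem_polySubalgebra _ _

end MvPowerSeries

theorem IsProperLinearSet.exists_periods {M : Type*} [AddCommMonoid M] {C : Set M}
    (hC : IsProperLinearSet C) : ∃ (a : M) (t : Finset M),
      (∀ l l' : t → ℕ, ∑ v, l v • (v : M) = ∑ v, l' v • (v : M) → l = l') ∧
      ∀ x, x ∈ C ↔ ∃ l : t → ℕ, x = a + ∑ v, l v • (v : M) := by
  obtain ⟨a, t, ht, rfl⟩ := isProperLinearSet_iff.1 hC
  refine ⟨a, t, fun l l' h => funext (Fintype.linearIndependent_iffₛ.1 ht l l' h), fun x => ?_⟩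
  simp only [Set.mem_vadd_set, SetLike.mem_coe, AddSubmonoid.mem_closure_finset', vadd_eq_add]
  constructor
  · rintro ⟨_, ⟨l, rfl⟩, rfl⟩
    exact ⟨l, rfl⟩
  · rintro ⟨l, rfl⟩
    exact ⟨_, ⟨l, rfl⟩, rfl⟩

namespace MvPowerSeries

/-- The exponents that do not involve the distinguished variable and that belong to `B`. -/
def liftSet {σ : Type*} (B : Set (σ → ℕ)) : Set (Option σ →₀ ℕ) :=
  {e | e none = 0 ∧ (fun i => e (some i)) ∈ B}

/-- The generating series of a product of proper linear sets is rational. -/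
theorem isRational_indicatorSeries_liftSet {ι κ : Type*} [Finite ι] [Finite κ]
    {C : ι → Set (κ → ℕ)} (hC : ∀ j, IsProperLinearSet (C j)) :
    IsRational (indicatorSeries
      (liftSet {u : ι × κ → ℕ | ∀ j, (fun i => u (j, i)) ∈ C j})) := by
  choose a t hinj hmem using fun j => (hC j).exists_periods
  -- The periods of the product are the disjoint union of those of the factors, each acting in its
  -- own block, so they stay independent.
  let P : ((Σ j, t j) → ℕ) →+ (Option (ι × κ) →₀ ℕ) :=
    { toFun := fun l => Finsupp.equivFunOnFinite.symm fun o =>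
        o.elim 0 fun x => (∑ v, l ⟨x.1, v⟩ • (v : κ → ℕ)) x.2
      map_zero' := by ext (_ | x) <;> simp
      map_add' := fun l l' => by ext (_ | x) <;> simp [add_mul, Finset.sum_add_distrib] }
  have hP (l) (x : ι × κ) : P l (some x) = (∑ v, l ⟨x.1, v⟩ • (v : κ → ℕ)) x.2 := rfl
  have hP0 (l) : P l none = 0 := rfl
  let c : Option (ι × κ) →₀ ℕ := Finsupp.equivFunOnFinite.symm fun o =>
    o.elim 0 fun x => a x.1 x.2
  have hc (x : ι × κ) : c (some x) = a x.1 x.2 := rfl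
  have hc0 : c none = 0 := rfl
  refine isRational_indicatorSeries P (fun l l' h => ?_) c fun e => ?_
  · ext ⟨j, v⟩
    refine congrFun (hinj j (fun v => l ⟨j, v⟩) (fun v => l' ⟨j, v⟩) (funext fun i => ?_)) v
    exact DFunLike.congr_fun h (some (j, i))
  · constructor
    · rintro ⟨h0, he⟩
      choose l hl using fun j => (hmem j _).1 (he j)
      refine ⟨fun x => l x.1 x.2, ?_⟩
      ext (_ | ⟨j, i⟩)
      · rw [h0, Finsupp.add_apply, hc0, hP0]
      · rw [Finsupp.add_apply, hc, hP]
        exact congrFun (hl j) i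
    · rintro ⟨l, rfl⟩
      refine ⟨by rw [Finsupp.add_apply, hc0, hP0], fun j => (hmem j _).2 ⟨fun v => l ⟨j, v⟩, ?_⟩⟩
      rfl

end MvPowerSeries

/-! ### Determinants and adjugates over a subalgebra -/

namespace Matrix

theorem det_mem_subalgebra {R A n : Type*} [CommRing R] [CommRing A] [Algebra R A] [Fintype n]
    [DecidableEq n] (S : Subalgebra R A) {M : Matrix n n A} (hM : ∀ i j, M i j ∈ S) :
    M.det ∈ S := by
  rw [det_apply]
  refine sum_mem fun g _ => ?_
  rw [Units.smul_def]
  exact zsmul_mem (prod_mem fun i _ => hM _ _) _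

theorem adjugate_mem_subalgebra {R A n : Type*} [CommRing R] [CommRing A] [Algebra R A]
    [Fintype n] [DecidableEq n] (S : Subalgebra R A) {M : Matrix n n A} (hM : ∀ i j, M i j ∈ S)
    (i j : n) : M.adjugate i j ∈ S := by
  rw [adjugate_apply]
  refine det_mem_subalgebra S fun k l => ?_
  rw [updateRow_apply]
  split_ifs
  · rw [Pi.single_apply]
    split_ifs
    exacts [one_mem S, zero_mem S]
  · exact hM k l

end Matrix

/-! ### Runs and the transfer matrix -/

namespace ParikhAutomaton

variable {α Q : Type*} {d : ℕ}

open scoped Classical in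
/-- The steps of the runs of length `n` from the state `q` to a final state. -/
noncomputable def paths (A : ParikhAutomaton α Q d) :
    ℕ → Q → Finset (List ((α × (Fin d → ℕ)) × Q))
  | 0, q => if q ∈ A.final then {[]} else ∅
  | n + 1, q => {t ∈ A.finite_transitions.toFinset | t.1 = q}.biUnion fun t =>
      (A.paths n t.2.2).map ⟨List.cons t.2, List.cons_injective⟩

theorem mem_paths (A : ParikhAutomaton α Q d) {n : ℕ} {q : Q}
    {s : List ((α × (Fin d → ℕ)) × Q)} :
    s ∈ A.paths n q ↔
      s.length = n ∧ A.StepsFrom q s ∧ (s.map fun x => x.2).getLastD q ∈ A.final := by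
  induction n generalizing q s with
  | zero =>
    rw [paths, List.length_eq_zero_iff]
    split_ifs with h
    · rw [Finset.mem_singleton]
      constructor
      · rintro rfl
        exact ⟨rfl, trivial, h⟩
      · exact And.left
    · refine ⟨fun h => absurd h (Finset.notMem_empty _), ?_⟩
      rintro ⟨rfl, -, h'⟩
      exact absurd h' h
  | succ n ih =>
    simp only [paths, Finset.mem_biUnion, Finset.mem_filter, Set.Finite.mem_toFinset,
      Finset.mem_map, Function.Embedding.coeFn_mk, ih]
    constructor
    · rintro ⟨⟨p, l, q'⟩, ⟨ht, rfl⟩, s', ⟨h1, h2, h3⟩, rfl⟩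
      refine ⟨by simp [h1], ⟨ht, h2⟩, ?_⟩
      rw [List.map_cons, List.getLastD_cons]
      exact h3
    · rcases s with _ | ⟨⟨l, q'⟩, s⟩
      · simp
      · rintro ⟨h1, ⟨ht, h2⟩, h3⟩
        rw [List.map_cons, List.getLastD_cons] at h3
        exact ⟨(q, l, q'), ⟨ht, rfl⟩, s, ⟨by simpa using h1, h2, h3⟩, rfl⟩

open scoped Classical in
theorem sum_paths_succ {M : Type*} [AddCommMonoid M] (A : ParikhAutomaton α Q d) (n : ℕ) (q : Q)
    (g : List ((α × (Fin d → ℕ)) × Q) → M) :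
    ∑ s ∈ A.paths (n + 1) q, g s =
      ∑ t ∈ A.finite_transitions.toFinset with t.1 = q,
        ∑ s ∈ A.paths n t.2.2, g (t.2 :: s) := by
  rw [paths, Finset.sum_biUnion]
  · simp
  · intro t ht t' ht' hne
    refine Finset.disjoint_left.2 fun s hs hs' => hne ?_
    obtain ⟨u, -, rfl⟩ := Finset.mem_map.1 hs
    obtain ⟨u', -, h⟩ := Finset.mem_map.1 hs'
    have h2 : t'.2 = t.2 := (List.cons.inj h).1
    have h1 : t.1 = t'.1 :=
      (Finset.mem_filter.1 ht).2.trans (Finset.mem_filter.1 ht').2.symm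
    exact Prod.ext h1 h2.symm

open MvPowerSeries

variable {σ : Type*}

open scoped Classical in
/-- The generating series of the runs from `q` to a final state, for the weights `wt` of the
labels. -/
noncomputable def pathSeries (A : ParikhAutomaton α Q d)
    (wt : α × (Fin d → ℕ) → Option σ →₀ ℕ) (q : Q) : MvPowerSeries (Option σ) ℚ :=
  fun e => ∑ s ∈ A.paths (e none) q, if (s.map fun x => wt x.1).sum = e then 1 else 0

open scoped Classical in
theorem coeff_pathSeries (A : ParikhAutomaton α Q d) (wt : α × (Fin d → ℕ) → Option σ →₀ ℕ) (q : Q)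
    (e : Option σ →₀ ℕ) : coeff e (A.pathSeries wt q) =
      ∑ s ∈ A.paths (e none) q, if (s.map fun x => wt x.1).sum = e then 1 else 0 := rfl

-- Split off the first step. Since `wt` is 1 in the distinguished variable, that variable records
-- length, and the finite sum over runs of length `e none` misses no run of weight `e`.
open scoped Classical in
theorem pathSeries_eq (A : ParikhAutomaton α Q d) {wt : α × (Fin d → ℕ) → Option σ →₀ ℕ}
    (hwt : ∀ l, wt l none = 1) (q : Q) :
    A.pathSeries wt q = (if q ∈ A.final then 1 else 0) +
      ∑ t ∈ A.finite_transitions.toFinset with t.1 = q,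
        monomial (wt t.2.1) 1 * A.pathSeries wt t.2.2 := by
  ext e
  rw [map_add, map_sum, coeff_pathSeries]
  simp only [coeff_monomial_mul, one_mul]
  rcases h : e none with _ | n
  · rw [Finset.sum_eq_zero (s := Finset.filter _ _), add_zero, paths]
    · split_ifs
      · rw [Finset.sum_singleton, coeff_one, List.map_nil, List.sum_nil]
        simp only [eq_comm]
      · simp
    · intro t _
      rw [if_neg]
      intro hle
      have := hle none
      rw [hwt, h] at this
      omega
  · have h0 : coeff e (if q ∈ A.final then 1 else 0 : MvPowerSeries (Option σ) ℚ) = 0 := by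
      split_ifs
      · rw [coeff_one, if_neg]
        rintro rfl
        simp at h
      · simp
    rw [h0, zero_add, sum_paths_succ]
    refine Finset.sum_congr rfl fun t _ => ?_
    split_ifs with hle
    · rw [coeff_pathSeries, Finsupp.tsub_apply, h, hwt, Nat.add_sub_cancel]
      refine Finset.sum_congr rfl fun s _ => ?_
      simp only [List.map_cons, List.sum_cons, eq_tsub_iff_add_eq_of_le hle, add_comm]
    · refine Finset.sum_eq_zero fun s _ => if_neg fun hs => hle ?_
      rw [← hs, List.map_cons, List.sum_cons]
      exact le_self_add

/-- The generating series of the runs between given states is rational. -/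
theorem isRational_pathSeries [Finite Q] (A : ParikhAutomaton α Q d)
    {wt : α × (Fin d → ℕ) → Option σ →₀ ℕ} (hwt : ∀ l, wt l none = 1) (q : Q) :
    IsRational (A.pathSeries wt q) := by
  classical
  have := Fintype.ofFinite Q
  set M : Matrix Q Q (MvPowerSeries (Option σ) ℚ) := fun p p' =>
    ∑ t ∈ A.finite_transitions.toFinset with t.1 = p ∧ t.2.2 = p', monomial (wt t.2.1) 1 with hM
  set b : Q → MvPowerSeries (Option σ) ℚ := fun p => if p ∈ A.final then 1 else 0 with hb
  have hb_mem (p : Q) : b p ∈ polySubalgebra (Option σ) := by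
    simp only [hb]
    split_ifs
    exacts [one_mem _, zero_mem _]
  have hM_mem (p p' : Q) : M p p' ∈ polySubalgebra (Option σ) :=
    sum_mem fun t _ => monomial_mem_polySubalgebra _ _
  have hsub_mem (p p' : Q) : (1 - M) p p' ∈ polySubalgebra (Option σ) := by
    rw [Matrix.sub_apply, Matrix.one_apply]
    refine sub_mem ?_ (hM_mem p p')
    split_ifs
    exacts [one_mem _, zero_mem _]
  have heq : (1 - M).mulVec (A.pathSeries wt) = b := by
    ext1 p
    rw [Matrix.sub_mulVec, Matrix.one_mulVec, Pi.sub_apply, sub_eq_iff_eq_add, pathSeries_eq A hwt]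
    congr 1
    simp only [Matrix.mulVec, dotProduct, hM, Finset.sum_mul]
    rw [← Finset.sum_fiberwise (g := fun t => t.2.2)]
    refine Finset.sum_congr rfl fun p' _ => ?_
    rw [Finset.filter_filter]
    refine Finset.sum_congr rfl fun t ht => ?_
    rw [(Finset.mem_filter.1 ht).2.2]
  -- Every transition weight involves the distinguished variable, so `M` has zero constant term and
  -- the determinant has constant term 1.
  have hdet : (1 - M).det ≠ 0 := by
    intro h0
    have h1 := congrArg (constantCoeff (σ := Option σ) (R := ℚ)) h0
    rw [RingHom.map_det, map_sub, map_one, map_zero] at h1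
    have h2 : (constantCoeff (σ := Option σ) (R := ℚ)).mapMatrix M = 0 := by
      ext p p'
      rw [RingHom.mapMatrix_apply, Matrix.map_apply, Matrix.zero_apply, hM, map_sum]
      refine Finset.sum_eq_zero fun t _ => ?_
      rw [← coeff_zero_eq_constantCoeff_apply, coeff_monomial, if_neg]
      intro h
      have := DFunLike.congr_fun h none
      simp [hwt] at this
    simp [h2] at h1
  refine ⟨_, Matrix.det_mem_subalgebra _ hsub_mem, hdet, ?_⟩
  have h3 : (1 - M).det • A.pathSeries wt = (1 - M).adjugate.mulVec b := by
    rw [← heq, Matrix.mulVec_mulVec, Matrix.adjugate_mul, Matrix.smul_mulVec, Matrix.one_mulVec]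
  have h4 := congrFun h3 q
  rw [Pi.smul_apply, smul_eq_mul] at h4
  rw [h4]
  exact sum_mem fun p _ => mul_mem (Matrix.adjugate_mem_subalgebra _ hsub_mem q p) (hb_mem p)

/-! ### Constrained runs as a diagonal -/

variable [Fintype σ]

/-- Complementary weights put the pairing of a run with its own vector on the diagonal of slope `K`;
the bound `hK` makes the truncated subtraction exact. -/
theorem sum_weights_add (A : ParikhAutomaton α Q d) {vec : α × (Fin d → ℕ) → σ → ℕ} {K : σ → ℕ}
    (hK : ∀ t ∈ A.transitions, vec t.2.1 ≤ K) {q : Q} {s : List ((α × (Fin d → ℕ)) × Q)}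
    (hs : A.StepsFrom q s) :
    (s.map fun x => diagExp 0 1 (K - vec x.1)).sum + diagExp 0 0 (s.map fun x => vec x.1).sum =
      diagExp K s.length 0 := by
  induction s generalizing q with
  | nil => ext (_ | i) <;> simp
  | cons x s ih =>
    obtain ⟨l, q'⟩ := x
    have h1 := ih hs.2
    have h2 := hK _ hs.1
    ext (_ | i)
    · have h3 := DFunLike.congr_fun h1 none
      simp only [Finsupp.add_apply, diagExp_none] at h3
      simp only [List.map_cons, List.sum_cons, Finsupp.add_apply, diagExp_none, List.length_cons]
      omega
    · have h3 := DFunLike.congr_fun h1 (some i)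
      have h4 : vec l i ≤ K i := h2 i
      simp only [Finsupp.add_apply, diagExp_some] at h3
      simp only [List.map_cons, List.sum_cons, Finsupp.add_apply, diagExp_some, Pi.add_apply,
        Pi.sub_apply, Pi.zero_apply, List.length_cons, add_mul, one_mul, mul_zero] at h3 ⊢
      omega

/-- The generating series of the runs with a vector in a set that has a rational generating
series is holonomic. -/
theorem isHolonomic_sum_paths [Finite Q] (A : ParikhAutomaton α Q d)
    (vec : α × (Fin d → ℕ) → σ → ℕ) {B : Set (σ → ℕ)}
    (hB : IsRational (indicatorSeries (liftSet B))) (q : Q) :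
    IsHolonomic (PowerSeries.mk fun n =>
      ∑ s ∈ A.paths n q, B.indicator (1 : (σ → ℕ) → ℚ) (s.map fun x => vec x.1).sum) := by
  classical
  obtain ⟨K, hK⟩ : ∃ K : σ → ℕ, ∀ t ∈ A.transitions, vec t.2.1 ≤ K := by
    obtain ⟨K, hK⟩ := (A.finite_transitions.image fun t => vec t.2.1).bddAbove
    exact ⟨K, fun t ht => hK ⟨t, ht, rfl⟩⟩
  set wt : α × (Fin d → ℕ) → Option σ →₀ ℕ := fun l => diagExp 0 1 (K - vec l) with hwt
  have h := ((A.isRational_pathSeries (wt := wt) (fun l => rfl) q).mul hB).isHolonomic_diagonal K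
  convert h using 3 with n
  -- The constraint series is free of the distinguished variable, so only runs of length `n` matter
  -- and the path series may be replaced by a finite sum of monomials.
  have h1 : coeff (diagExp K n 0) (A.pathSeries wt q * indicatorSeries (liftSet B)) =
      coeff (diagExp K n 0) ((∑ s ∈ A.paths n q, monomial (s.map fun x => wt x.1).sum (1 : ℚ)) *
        indicatorSeries (liftSet B)) := by
    rw [coeff_mul, coeff_mul]
    refine Finset.sum_congr rfl fun x hx => ?_
    by_cases hx0 : x.2 none = 0
    · have hx1 := DFunLike.congr_fun (Finset.HasAntidiagonal.mem_antidiagonal.1 hx) none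
      rw [Finsupp.add_apply, hx0, diagExp_none, add_zero] at hx1
      rw [coeff_pathSeries, hx1, map_sum]
      congr 1
      refine Finset.sum_congr rfl fun s _ => ?_
      rw [coeff_monomial]
      simp only [eq_comm]
    · have : coeff x.2 (indicatorSeries (liftSet B)) = 0 :=
        Set.indicator_of_notMem (fun h => hx0 h.1) _
      rw [this, mul_zero, mul_zero]
  rw [h1, Finset.sum_mul, map_sum]
  refine Finset.sum_congr rfl fun s hs => ?_
  obtain ⟨hlen, hsteps, -⟩ := A.mem_paths.1 hs
  have hw := A.sum_weights_add hK hsteps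
  rw [hlen] at hw
  rw [← hw, coeff_monomial_mul, if_pos le_self_add, add_tsub_cancel_left, one_mul,
    coeff_indicatorSeries]
  simp only [Set.indicator_apply, liftSet, Set.mem_ofPred_eq, diagExp_none, diagExp_some]
  simp

/-! ### From words to runs, and inclusion-exclusion -/

/-- Reading the label maps accepting runs onto words of the language; weak unambiguity is exactly
its injectivity. -/
theorem ncard_language (A : ParikhAutomaton α Q d) (hA : A.WeaklyUnambiguous) (n : ℕ) :
    (Set.ncard {w : List α | w ∈ A.language ∧ w.length = n} : ℚ) =
      ∑ s ∈ A.paths n A.initial,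
        A.constraint.indicator (1 : (Fin d → ℕ) → ℚ) (s.map fun x => x.1.2).sum := by
  classical
  simp only [Set.indicator_apply, Pi.one_apply, Finset.sum_boole]
  rw [← Set.ncard_coe_finset, Nat.cast_inj]
  symm
  refine Set.ncard_congr (fun s _ => s.map fun x => x.1.1) ?_ ?_ ?_
  · intro s hs
    obtain ⟨hs, hC⟩ := Finset.mem_filter.1 hs
    obtain ⟨h1, h2, h3⟩ := A.mem_paths.1 hs
    exact ⟨⟨⟨A.initial, s⟩, ⟨h2, rfl, h3, hC⟩, rfl⟩, by simp [h1]⟩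
  · intro s s' hs hs' h
    obtain ⟨hs, hC⟩ := Finset.mem_filter.1 hs
    obtain ⟨-, h2, h3⟩ := A.mem_paths.1 hs
    obtain ⟨hs', hC'⟩ := Finset.mem_filter.1 hs'
    obtain ⟨-, h2', h3'⟩ := A.mem_paths.1 hs'
    exact congrArg ParikhRun.steps (hA _ ⟨A.initial, s⟩ ⟨A.initial, s'⟩ ⟨h2, rfl, h3, hC⟩ h
      ⟨h2', rfl, h3', hC'⟩ rfl)
  · rintro w ⟨⟨⟨p, s⟩, ⟨h2, h0, h3, hC⟩, rfl⟩, hn⟩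
    obtain rfl : p = A.initial := h0
    refine ⟨s, Finset.mem_filter.2 ⟨A.mem_paths.2 ⟨?_, h2, h3⟩, hC⟩, rfl⟩
    simpa [ParikhRun.word] using hn

/-- A coordinate of the sum of the vectors repeated along `J`. -/
theorem sum_map_comp_snd {J : Type*} (s : List ((α × (Fin d → ℕ)) × Q)) (y : J × Fin d) :
    (s.map fun x => fun y : J × Fin d => x.1.2 y.2).sum y = (s.map fun x => x.1.2).sum y.2 := by
  induction s with
  | nil => rfl
  | cons x s ih => simp only [List.map_cons, List.sum_cons, Pi.add_apply, ih]

/-- Inclusion-exclusion over the linear sets of the constraint. -/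
theorem languageGenSeries_eq_sum (A : ParikhAutomaton α Q d) (hA : A.WeaklyUnambiguous)
    {S : Finset (Set (Fin d → ℕ))} (hC : A.constraint = ⋃₀ S) :
    languageGenSeries A.language =
      ∑ J ∈ S.powerset with J.Nonempty, (-1 : ℤ) ^ (J.card + 1) • PowerSeries.mk fun n =>
        ∑ s ∈ A.paths n A.initial,
          {u : J × Fin d → ℕ | ∀ j : J, (fun i => u (j, i)) ∈ (j : Set (Fin d → ℕ))}.indicator
            (1 : (J × Fin d → ℕ) → ℚ) (s.map fun x => fun y : J × Fin d => x.1.2 y.2).sum := by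
  classical
  ext n
  rw [languageGenSeries, PowerSeries.coeff_mk, A.ncard_language hA, map_sum]
  simp only [map_zsmul, PowerSeries.coeff_mk, Finset.smul_sum]
  rw [Finset.sum_comm]
  refine Finset.sum_congr rfl fun s _ => ?_
  rw [hC, Set.sUnion_eq_biUnion]
  simp only [SetLike.mem_coe]
  rw [Finset.indicator_biUnion_eq_sum_powerset S fun C => C]
  refine Finset.sum_congr rfl fun J _ => ?_
  congr 1
  simp only [Set.indicator_apply, Pi.one_apply]
  congr 1
  -- Lying in every member of `J` means that the vector repeated along `J` lies in the product of
  -- the members.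
  simp only [Set.mem_iInter, Set.mem_ofPred_eq, sum_map_comp_snd, Subtype.forall]

end ParikhAutomaton

theorem proposition3p2 {α Q : Type*} [Finite α] [Finite Q] {d : ℕ}
    (A : ParikhAutomaton α Q d) (hA : A.WeaklyUnambiguous) :
    IsHolonomic (languageGenSeries A.language) := by
  obtain ⟨S, hS, hC⟩ :=
    isProperSemilinearSet_iff.1 A.semilinear_constraint.isProperSemilinearSet
  rw [A.languageGenSeries_eq_sum hA hC]
  refine IsHolonomic.sum fun J hJ => IsHolonomic.zsmul _ ?_
  refine A.isHolonomic_sum_paths (σ := J × Fin d) (fun l y => l.2 y.2)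
    (MvPowerSeries.isRational_indicatorSeries_liftSet
      (C := fun j : J => (j : Set (Fin d → ℕ))) fun j => ?_) A.initial
  exact hS _ (Finset.mem_powerset.1 (Finset.mem_filter.1 hJ).1 j.2)
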